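/- Let $G$ be a Feynman graph: a finite connected multigraph with internal edges $1,\dots,n$ (loops and parallel edges allowed) and external edges (legs) $1,\dots,L$, each leg being attached to one vertex. Assume that $G$ has no bridges, i.e. deleting any single internal edge leaves $G$ connected. The kinematic parameters of $G$ are the vectors $z=(m,k)$, where $m=(m_1,\dots,m_n)\in\mathbb{R}^n$ is an arbitrary vector of (squared) internal masses and $k=(k_{ij})$ is an arbitrary real symmetric $L\times L$ matrix with zero row sums; they form a real vector space of dimension $n+\binom{L}{2}$. Let $$\mathcal{U}(x)=\sum_{T}\prod_{e\notin T}x_e,\qquad \mathcal{F}_z(x)=\sum_{\{T_1,T_2\}}\Bigl(\sum_{i\in I_{T_1}}\sum_{j\in I_{T_2}}k_{ij}\Bigr)\prod_{e\notin T_1\sqcup T_2}x_e+\Bigl(\sum_{e=1}^n m_ex_e\Bigr)\,\mathcal{U}(x)$$ be the Symanzik polynomials of $G$ in the variables $x_1,\dots,x_n$, where $T$ runs over the spanning trees and $\{T_1,T_2\}$ over the spanning 2-forests of $G$ (acyclic spanning subgraphs with exactly two connected components $T_1,T_2$), and $I_{T_1},I_{T_2}$ are the sets of legs attached to $T_1,T_2$.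 Let $\mathcal{C}_G$ be the copositive cone, i.e. the set of all kinematic parameters $z$ with $\mathcal{F}_z(x)\ge 0$ for all $x\in\mathbb{R}^n_{\ge 0}$. Then a kinematic parameter vector $z$ lies in the interior of $\mathcal{C}_G$, taken in the space of kinematic parameters, if and only if $m_1,\dots,m_n>0$ and there exists $N\in\mathbb{N}$ such that $(x_1+\dots+x_n)^N\,\mathcal{F}_z$ has only positive coefficients, i.e. all of its nonzero coefficients are positive. -/

import Mathlib

/-- The combinatorial data of a Feynman graph: a finite multigraph with vertex set `V` and internal
edges `E` (loops and parallel edges are allowed), and external edges (legs) `L`, each attached to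
one vertex. The valency-one end points of the legs are not listed in `V`. -/
structure FeynmanGraph (V E L : Type*) where
  /-- The two end points of an internal edge. -/
  ends : E → Sym2 V
  /-- The vertex to which an external edge is attached. -/
  leg : L → V

namespace FeynmanGraph

variable {V E L : Type*}

/-- The adjacency structure of the spanning subgraph whose internal edges are those in `S`; it has
the same connected components as this subgraph. -/
def sub (G : FeynmanGraph V E L) (S : Set E) : SimpleGraph V :=
  SimpleGraph.fromEdgeSet (G.ends '' S)

/-- `G` is connected (in particular it has a vertex). -/
def IsConnected (G : FeynmanGraph V E L) : Prop :=
  (G.sub Set.univ).Connected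

/-- `G` has no bridges: no internal edge disconnects `G` when it is removed. -/
def IsBridgeless (G : FeynmanGraph V E L) : Prop :=
  ∀ e : E, (G.sub {e}ᶜ).Connected

/-- The edge set `S` contains no cycle: no cycle of length one (a loop), none of length two (a pair
of parallel edges) and none of length at least three. -/
def IsForest (G : FeynmanGraph V E L) (S : Set E) : Prop :=
  (∀ e ∈ S, ¬ (G.ends e).IsDiag) ∧ Set.InjOn G.ends S ∧ (G.sub S).IsAcyclic

/-- Edge sets of spanning trees. -/
def IsSpanningTree (G : FeynmanGraph V E L) (S : Set E) : Prop :=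
  G.IsForest S ∧ (G.sub S).Connected

/-- Edge sets of spanning 2-forests: no cycle, and exactly two connected components. -/
def IsTwoForest (G : FeynmanGraph V E L) (S : Set E) : Prop :=
  G.IsForest S ∧ Nat.card (G.sub S).ConnectedComponent = 2

/-- The component of the spanning subgraph `S` to which the leg `i` is attached. -/
def legComponent (G : FeynmanGraph V E L) (S : Set E) (i : L) : (G.sub S).ConnectedComponent :=
  (G.sub S).connectedComponentMk (G.leg i)

/-- The kinematic space: vectors `(m, k)` of internal (squared) masses `m`, which are arbitrary real
numbers, and a symmetric matrix `k` with zero row sums, indexed by the legs. -/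
def KinematicSpace (E L : Type*) [Fintype L] : Submodule ℝ ((E → ℝ) × Matrix L L ℝ) where
  carrier := {z | z.2.IsSymm ∧ ∀ i, ∑ j, z.2 i j = 0}
  add_mem' := by
    rintro a b ⟨ha, ha'⟩ ⟨hb, hb'⟩
    refine ⟨ha.add hb, fun i => ?_⟩
    simp [Finset.sum_add_distrib, ha', hb']
  zero_mem' := by
    refine ⟨Matrix.isSymm_zero, fun i => ?_⟩
    simp
  smul_mem' := by
    rintro c a ⟨ha, ha'⟩
    refine ⟨ha.smul c, fun i => ?_⟩
    simp [← Finset.mul_sum, ha']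

section Symanzik

variable [Fintype L]

open Classical in
/-- The sum of `k i j` over the pairs of legs `i`, `j` with `i` attached to one component of the
2-forest `S` and `j` to the other. Each unordered pair of legs in different components occurs twice
in the double sum, whence the factor `1 / 2`; see `crossing_eq`. -/
noncomputable def crossing (G : FeynmanGraph V E L) (S : Set E) (k : Matrix L L ℝ) : ℝ :=
  (1 / 2) * ∑ i : L, ∑ j : L with G.legComponent S i ≠ G.legComponent S j, k i j

open Classical in
/-- If `T₁`, `T₂` are the two components of the 2-forest `S`, then `crossing` is the sum of `k i j`
over the legs `i` at `T₁` and `j` at `T₂`. -/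
theorem crossing_eq (G : FeynmanGraph V E L) {S : Set E} (hS : G.IsTwoForest S)
    {k : Matrix L L ℝ} (hk : k.IsSymm) {T₁ T₂ : (G.sub S).ConnectedComponent} (hT : T₁ ≠ T₂) :
    G.crossing S k =
      ∑ i : L with G.legComponent S i = T₁, ∑ j : L with G.legComponent S j = T₂, k i j := by
  have hall : ∀ C : (G.sub S).ConnectedComponent, C = T₁ ∨ C = T₂ := by
    intro C
    by_contra! h
    have : Finite (G.sub S).ConnectedComponent :=
      Nat.finite_of_card_ne_zero (by rw [hS.2]; norm_num)
    have := Fintype.ofFinite (G.sub S).ConnectedComponent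
    have h3 : ({C, T₁, T₂} : Finset _).card = 3 := Finset.card_eq_three.2
      ⟨C, T₁, T₂, h.1, h.2, hT, rfl⟩
    have := Finset.card_le_univ ({C, T₁, T₂} : Finset (G.sub S).ConnectedComponent)
    rw [h3, ← Nat.card_eq_fintype_card, hS.2] at this
    omega
  have key : ∀ i j : L, (if G.legComponent S i ≠ G.legComponent S j then k i j else 0) =
      (if G.legComponent S i = T₁ then (if G.legComponent S j = T₂ then k i j else 0) else 0) +
      (if G.legComponent S j = T₁ then (if G.legComponent S i = T₂ then k j i else 0) else 0) := by
    intro i j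
    have hs : k j i = k i j := hk.apply i j
    rcases hall (G.legComponent S i) with h1 | h1 <;>
      rcases hall (G.legComponent S j) with h2 | h2 <;>
      simp [h1, h2, hT, hT.symm, hs]
  unfold crossing
  simp only [Finset.sum_filter, key, Finset.sum_add_distrib, Finset.sum_ite_irrel,
    Finset.sum_const_zero]
  rw [Finset.sum_comm (f := fun i j => if G.legComponent S j = T₁ then
    (if G.legComponent S i = T₂ then k j i else 0) else 0)]
  simp only [Finset.sum_ite_irrel, Finset.sum_const_zero]
  ring

variable [Fintype E]

open Classical in
/-- The first Symanzik polynomial. -/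
noncomputable def firstSymanzik (G : FeynmanGraph V E L) : MvPolynomial E ℝ :=
  ∑ T : Finset E with G.IsSpanningTree (T : Set E),
    ∏ e : E with e ∉ T, MvPolynomial.X e

open Classical in
/-- The second Symanzik polynomial `F_z`, for `z = (m, k)`. -/
noncomputable def secondSymanzik (G : FeynmanGraph V E L) (z : KinematicSpace E L) :
    MvPolynomial E ℝ :=
  (∑ S : Finset E with G.IsTwoForest (S : Set E),
      MvPolynomial.C (G.crossing (S : Set E) z.1.2) * ∏ e : E with e ∉ S, MvPolynomial.X e) +
    (∑ e : E, MvPolynomial.C (z.1.1 e) * MvPolynomial.X e) * G.firstSymanzik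

/-- The copositive cone: all kinematic vectors `z` such that `F_z` is nonnegative on the
nonnegative orthant. -/
def copositiveCone (G : FeynmanGraph V E L) : Set (KinematicSpace E L) :=
  {z | ∀ x : E → ℝ, (∀ e, 0 ≤ x e) → 0 ≤ MvPolynomial.eval x (G.secondSymanzik z)}

end Symanzik

end FeynmanGraph

/-- All coefficients that occur in the polynomial `f` are positive. -/
def HasOnlyPositiveCoeffs {σ : Type*} (f : MvPolynomial σ ℝ) : Prop :=
  ∀ d ∈ f.support, 0 < f.coeff d

/-! Write σ = ∑ x_e. Both conditions are equivalent to strict copositivity (`IsStrictlyCopositive`):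
F_z ≥ ε σ U on the orthant for some ε > 0. The weight σU is the right one because every 2-forest is
a spanning tree minus an edge, so each monomial of F_z is bounded by σU. In particular F_z vanishes
wherever U does, and strict positivity on the simplex would be too much to ask.

Interior: lowering all masses by t changes F_z by -tσU, so interior points are strictly copositive
(`of_mem_interior`); conversely a small perturbation of z changes F_z by at most εσU
(`mem_interior`). Positive masses (`mass_pos`) come from points vanishing on a spanning tree T that
avoids e: there F_z reduces to (∑ m_f x_f) ∏_{f∉T} x_f.

Pólya direction: the coefficient of x^c in σ^N F_z, times c!/N!, equals F_z(c) minus a correction,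
since a square x_i² contributes c_i(c_i - 1) instead of c_i²
(`prod_factorial_mul_coeff_secondSymanzik`). The correction is at most a constant times U(c), while
F_z(c) ≥ ε|c|U(c) with |c| ≥ N.

Converse: the same formula shows that x_e^(N+1) ∏_{f∉T} x_f has a positive coefficient in σ^N F_z
when e ∉ T; tree exchange, available as there are no bridges, handles e ∈ T. Taking e with x_e
maximal, hence comparable to σ, and summing over T gives strict copositivity
(`of_hasOnlyPositiveCoeffs`). -/

namespace FeynmanGraph

/-! ### Spanning trees and 2-forests of a multigraph -/

section Graph

variable {V E L : Type*} {G : FeynmanGraph V E L}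

theorem sub_adj {S : Set E} {a b : V} :
    (G.sub S).Adj a b ↔ (∃ g ∈ S, G.ends g = s(a, b)) ∧ a ≠ b := by
  simp [sub]

theorem sub_mono {S T : Set E} (h : S ⊆ T) : G.sub S ≤ G.sub T :=
  SimpleGraph.fromEdgeSet_mono (Set.image_mono h)

theorem reachable_of_ends {S : Set E} {g : E} (hg : g ∈ S) {a b : V} (h : G.ends g = s(a, b)) :
    (G.sub S).Reachable a b := by
  by_cases hab : a = b
  · subst hab; exact SimpleGraph.Reachable.refl _
  · exact (sub_adj.2 ⟨⟨g, hg, h⟩, hab⟩).reachable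

/-- A subgraph whose edges all join `S`-reachable vertices has no more reachability than `S`. -/
theorem reachable_of_forall_ends {A S : Set E}
    (h : ∀ f ∈ A, ∀ p q, G.ends f = s(p, q) → (G.sub S).Reachable p q) {a b : V}
    (hab : (G.sub A).Reachable a b) : (G.sub S).Reachable a b := by
  obtain ⟨w⟩ := hab
  induction w with
  | nil => exact SimpleGraph.Reachable.refl _
  | cons hadj _ ih =>
    obtain ⟨⟨g, hg, hge⟩, -⟩ := sub_adj.1 hadj
    exact (h g hg _ _ hge).trans ih

theorem reachable_insert_cases {S : Set E} {f : E} {u v : V} (hf : G.ends f = s(u, v)) {a b : V}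
    (hab : (G.sub (insert f S)).Reachable a b) :
    (G.sub S).Reachable a b ∨ ((G.sub S).Reachable a u ∧ (G.sub S).Reachable v b) ∨
      ((G.sub S).Reachable a v ∧ (G.sub S).Reachable u b) := by
  obtain ⟨w⟩ := hab
  induction w with
  | nil => exact Or.inl (SimpleGraph.Reachable.refl _)
  | @cons x y c hadj _ ih =>
    obtain ⟨⟨g, hg, hge⟩, -⟩ := sub_adj.1 hadj
    rcases hg with rfl | hg
    · rw [hf, Sym2.eq_iff] at hge
      have hr : ∀ t : V, (G.sub S).Reachable t t := SimpleGraph.Reachable.refl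
      rcases hge with ⟨rfl, rfl⟩ | ⟨rfl, rfl⟩
      · rcases ih with h | ⟨h, h'⟩ | ⟨h, h'⟩
        · exact Or.inr (Or.inl ⟨hr _, h⟩)
        · exact Or.inr (Or.inl ⟨hr _, h'⟩)
        · exact Or.inl h'
      · rcases ih with h | ⟨h, h'⟩ | ⟨h, h'⟩
        · exact Or.inr (Or.inr ⟨hr _, h⟩)
        · exact Or.inl h'
        · exact Or.inr (Or.inr ⟨hr _, h'⟩)
    · have hxy := reachable_of_ends hg hge
      rcases ih with h | ⟨h, h'⟩ | ⟨h, h'⟩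
      · exact Or.inl (hxy.trans h)
      · exact Or.inr (Or.inl ⟨hxy.trans h, h'⟩)
      · exact Or.inr (Or.inr ⟨hxy.trans h, h'⟩)

theorem IsForest.insert {S : Set E} (hS : G.IsForest S) {f : E} {u v : V}
    (hf : G.ends f = s(u, v)) (huv : ¬ (G.sub S).Reachable u v) :
    G.IsForest (insert f S) := by
  have hne : u ≠ v := by rintro rfl; exact huv (SimpleGraph.Reachable.refl _)
  have hfS : ∀ g ∈ S, G.ends g ≠ G.ends f := fun g hg h =>
    huv (reachable_of_ends hg (h.trans hf))
  refine ⟨?_, ?_, ?_⟩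
  · rintro e (rfl | he)
    · rw [hf]; simpa using hne
    · exact hS.1 e he
  · rintro a (rfl | ha) b (rfl | hb) hab
    · rfl
    · exact (hfS b hb hab.symm).elim
    · exact (hfS a ha hab).elim
    · exact hS.2.1 ha hb hab
  · have : G.sub (Insert.insert f S) = G.sub S ⊔ SimpleGraph.edge u v := by
      rw [sub, Set.image_insert_eq, hf, Set.insert_eq, Set.union_comm,
        SimpleGraph.fromEdgeSet_union]
      rfl
    rw [this]
    exact hS.2.2.sup_edge_of_not_reachable huv

/-- A forest with at most two components becomes a spanning tree when an edge joining two
components is added. -/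
theorem IsForest.isSpanningTree_insert {S : Set E} (hS : G.IsForest S) {u v : V}
    (hall : ∀ w, (G.sub S).Reachable u w ∨ (G.sub S).Reachable v w) {f : E} {p q : V}
    (hf : G.ends f = s(p, q)) (hpq : ¬ (G.sub S).Reachable p q) :
    G.IsSpanningTree (Insert.insert f S) := by
  refine ⟨hS.insert hf hpq, ?_⟩
  have hall' : ∀ w, (G.sub S).Reachable p w ∨ (G.sub S).Reachable q w := by
    intro w
    rcases hall p with hp | hp <;> rcases hall q with hq | hq <;> rcases hall w with hw | hw
    · exact Or.inl (hp.symm.trans hw)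
    · exact (hpq (hp.symm.trans hq)).elim
    · exact Or.inl (hp.symm.trans hw)
    · exact Or.inr (hq.symm.trans hw)
    · exact Or.inr (hq.symm.trans hw)
    · exact Or.inl (hp.symm.trans hw)
    · exact (hpq (hp.symm.trans hq)).elim
    · exact Or.inl (hp.symm.trans hw)
  have hm := sub_mono (G := G) (Set.subset_insert f S)
  have hpq' := reachable_of_ends (Set.mem_insert f S) hf
  have hp : ∀ w, (G.sub (Insert.insert f S)).Reachable p w := fun w =>
    (hall' w).elim (fun h => h.mono hm) fun h => hpq'.trans (h.mono hm)
  exact (SimpleGraph.connected_iff _).2 ⟨fun a b => (hp a).symm.trans (hp b), ⟨p⟩⟩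

theorem IsTwoForest.exists_isSpanningTree_insert (hconn : G.IsConnected) {S : Set E}
    (hS : G.IsTwoForest S) : ∃ f ∉ S, G.IsSpanningTree (insert f S) := by
  obtain ⟨C, D, hCD, huniv⟩ := Nat.card_eq_two_iff.1 hS.2
  obtain ⟨u, rfl⟩ := C.exists_rep
  obtain ⟨v, rfl⟩ := D.exists_rep
  have huv : ¬ (G.sub S).Reachable u v := fun h => hCD (SimpleGraph.ConnectedComponent.sound h)
  have hall : ∀ w, (G.sub S).Reachable u w ∨ (G.sub S).Reachable v w := by
    intro w
    have hw : (G.sub S).connectedComponentMk w ∈ (Set.univ : Set _) := Set.mem_univ _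
    rw [← huniv] at hw
    rcases hw with h | h
    · exact Or.inl (SimpleGraph.ConnectedComponent.exact h).symm
    · exact Or.inr (SimpleGraph.ConnectedComponent.exact h).symm
  have : ∃ f p q, G.ends f = s(p, q) ∧ ¬ (G.sub S).Reachable p q := by
    by_contra! h
    exact huv (reachable_of_forall_ends (A := Set.univ) (fun f _ p q => h f p q)
      (hconn.preconnected u v))
  obtain ⟨f, p, q, hf, hpq⟩ := this
  exact ⟨f, fun h => hpq (reachable_of_ends h hf), hS.1.isSpanningTree_insert hall hf hpq⟩

/-- Tree exchange: an edge of a spanning tree that is not a bridge can be replaced. -/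
theorem IsSpanningTree.exists_exchange {T : Set E} (hT : G.IsSpanningTree T) {e : E} (he : e ∈ T)
    (hb : (G.sub {e}ᶜ).Connected) : ∃ f ∉ T, G.IsSpanningTree (insert f (T \ {e})) := by
  obtain ⟨u, v, hends⟩ : ∃ u v, G.ends e = s(u, v) := by
    induction h : G.ends e with | _ u v => exact ⟨u, v, rfl⟩
  have hne : u ≠ v := by
    have := hT.1.1 e he
    rw [hends] at this
    simpa using this
  -- In an acyclic simple graph every edge is a bridge. Injectivity of `ends` on `T` ensures that no
  -- parallel edge survives the removal of `e`.
  have huv : ¬ (G.sub (T \ {e})).Reachable u v := by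
    intro h
    have hbr := SimpleGraph.isAcyclic_iff_forall_isBridge.1 hT.1.2.2
      (show s(u, v) ∈ (G.sub T).edgeSet from sub_adj.2 ⟨⟨e, he, hends⟩, hne⟩)
    refine SimpleGraph.isBridge_iff.1 hbr (h.mono ?_)
    intro a b hab
    obtain ⟨⟨g, hg, hge⟩, hab⟩ := sub_adj.1 hab
    rw [SimpleGraph.deleteEdges_adj]
    refine ⟨sub_adj.2 ⟨⟨g, hg.1, hge⟩, hab⟩, fun h => hg.2 ?_⟩
    exact hT.1.2.1 hg.1 he (hge.trans (h.trans hends.symm))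
  have hall : ∀ w, (G.sub (T \ {e})).Reachable u w ∨ (G.sub (T \ {e})).Reachable v w := by
    intro w
    have h := hT.2.preconnected u w
    rw [← Set.insert_sdiff_self_of_mem he] at h
    rcases reachable_insert_cases hends h with h | h | h
    · exact Or.inl h
    · exact Or.inr h.2
    · exact Or.inl h.2
  have : ∃ f ∈ ({e}ᶜ : Set E), ∃ p q, G.ends f = s(p, q) ∧
      ¬ (G.sub (T \ {e})).Reachable p q := by
    by_contra! h
    exact huv (reachable_of_forall_ends h (hb.preconnected u v))
  obtain ⟨f, hfe, p, q, hf, hpq⟩ := this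
  have hforest : G.IsForest (T \ {e}) :=
    ⟨fun g hg => hT.1.1 g hg.1, hT.1.2.1.mono Set.sdiff_subset,
      hT.1.2.2.anti (sub_mono Set.sdiff_subset)⟩
  exact ⟨f, fun h => hpq (reachable_of_ends (S := T \ {e}) ⟨h, hfe⟩ hf),
    hforest.isSpanningTree_insert hall hf hpq⟩

/-- Choosing one internal edge over each edge of a spanning tree of the underlying simple graph
leaves no loops or parallel edges. -/
theorem exists_isSpanningTree_subset {A : Set E} (hA : (G.sub A).Connected) :
    ∃ T ⊆ A, G.IsSpanningTree T := by
  obtain ⟨H, hle, hH⟩ := hA.exists_isTree_le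
  have hex : ∀ d : H.edgeSet, ∃ g ∈ A, G.ends g = d.1 := by
    rintro ⟨d, hd⟩
    have hd' := SimpleGraph.edgeSet_mono hle hd
    rw [sub, SimpleGraph.edgeSet_fromEdgeSet] at hd'
    exact hd'.1
  choose g hgA hg using hex
  have himg : G.ends '' Set.range g = H.edgeSet := by
    ext d
    constructor
    · rintro ⟨_, ⟨d', rfl⟩, rfl⟩
      rw [hg]; exact d'.2
    · intro hd
      exact ⟨g ⟨d, hd⟩, ⟨_, rfl⟩, hg _⟩
  have hsub : G.sub (Set.range g) = H := by
    rw [sub, himg, SimpleGraph.fromEdgeSet_edgeSet]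
  refine ⟨Set.range g, ?_, ⟨?_, ?_, ?_⟩, ?_⟩
  · rintro _ ⟨d, rfl⟩; exact hgA d
  · rintro _ ⟨d, rfl⟩
    rw [hg]; exact H.not_isDiag_of_mem_edgeSet d.2
  · rintro _ ⟨d, rfl⟩ _ ⟨d', rfl⟩ h
    rw [hg, hg] at h
    rw [Subtype.ext h]
  · rw [hsub]; exact hH.isAcyclic
  · rw [hsub]; exact hH.connected

theorem IsSpanningTree.ncard_add_one [Fintype V] {T : Set E} (hT : G.IsSpanningTree T) :
    T.ncard + 1 = Fintype.card V := by
  classical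
  have hedge : (G.sub T).edgeSet = G.ends '' T := by
    rw [sub, SimpleGraph.edgeSet_fromEdgeSet]
    refine sdiff_eq_left.2 (Set.disjoint_left.2 ?_)
    rintro _ ⟨g, hg, rfl⟩ h
    exact hT.1.1 g hg (by simpa using h)
  have htree : (G.sub T).IsTree := ⟨hT.2, hT.1.2.2⟩
  have := htree.card_edgeFinset
  rw [← this, ← hT.1.2.1.ncard_image, ← hedge, ← SimpleGraph.coe_edgeFinset,
    Set.ncard_coe_finset]

open Classical in
theorem IsTwoForest.exists_finset_insert (hconn : G.IsConnected) {S : Finset E}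
    (hS : G.IsTwoForest (S : Set E)) :
    ∃ f ∉ S, G.IsSpanningTree ((insert f S : Finset E) : Set E) := by
  obtain ⟨f, hf, hT⟩ := hS.exists_isSpanningTree_insert hconn
  exact ⟨f, by simpa using hf, by simpa using hT⟩

theorem IsSpanningTree.card_add_one [Fintype V] {T : Finset E} (hT : G.IsSpanningTree (T : Set E)) :
    T.card + 1 = Fintype.card V := by
  rw [← hT.ncard_add_one, Set.ncard_coe_finset]

end Graph
end FeynmanGraph

namespace MvPolynomial

/-! ### Coefficients of a monomial times a power of the sum of the variables -/

section MulSumPow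

variable {σ : Type*} [Fintype σ]

-- The coefficient is the multinomial N!/(c-b)!, and c!/(c-b)! is a product of falling factorials.
-- If b ≤ c fails, some falling factorial is zero and so is the coefficient.
open Nat in
theorem prod_factorial_mul_coeff_sum_X_pow_mul_monomial {N : ℕ} {c b : σ →₀ ℕ}
    (h : c.degree = N + b.degree) :
    ((∏ e, (c e)! : ℕ) : ℝ) * coeff c ((∑ e, X e : MvPolynomial σ ℝ) ^ N * monomial b 1) =
      (N ! : ℝ) * ∏ e, ((c e).descFactorial (b e) : ℝ) := by
  rw [coeff_mul_monomial']
  split_ifs with hbc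
  · have hdeg : (c - b).degree = N := by
      have h1 : (c - b).degree + b.degree = c.degree := by
        rw [← map_add, tsub_add_cancel_of_le hbc]
      omega
    have hsum : (c - b).sum (fun _ m => m) = N := by
      rw [← hdeg]; rfl
    rw [coeff_sum_X_pow_of_fintype, if_pos hsum, mul_one,
      ← Finsupp.multinomial_of_support_subset (Finset.subset_univ _)]
    have hspec := Nat.multinomial_spec Finset.univ (c - b : σ →₀ ℕ)
    rw [← Finsupp.degree_eq_sum, hdeg] at hspec
    have hfac : ∏ e, (c e)! = (∏ e, ((c - b) e)!) * ∏ e, (c e).descFactorial (b e) := by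
      rw [← Finset.prod_mul_distrib]
      refine Finset.prod_congr rfl fun e _ => ?_
      rw [Finsupp.tsub_apply, Nat.factorial_mul_descFactorial (hbc e)]
    rw [hfac, ← hspec]
    push_cast
    ring
  · obtain ⟨e, he⟩ : ∃ e, c e < b e := by
      by_contra! hle
      exact hbc hle
    have h0 : ∏ e, ((c e).descFactorial (b e) : ℝ) = 0 :=
      Finset.prod_eq_zero (Finset.mem_univ e) (by exact_mod_cast Nat.descFactorial_of_lt he)
    rw [h0, mul_zero, mul_zero]

open Nat in
theorem prod_factorial_mul_coeff_sum_X_pow_mul_prod_X {N : ℕ} {c : σ →₀ ℕ} {A : Finset σ}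
    (h : c.degree = N + A.card) :
    ((∏ e, (c e)! : ℕ) : ℝ) * coeff c ((∑ e, X e : MvPolynomial σ ℝ) ^ N * ∏ a ∈ A, X a) =
      (N ! : ℝ) * ∏ a ∈ A, (c a : ℝ) := by
  classical
  have hb : ∀ e, (∑ a ∈ A, Finsupp.single a 1 : σ →₀ ℕ) e = if e ∈ A then 1 else 0 := by
    intro e
    simp [Finsupp.finsetSum_apply, Finsupp.single_apply]
  have hmon : (∏ a ∈ A, X a : MvPolynomial σ ℝ) = monomial (∑ a ∈ A, Finsupp.single a 1) 1 := by
    rw [monomial_sum_one]; rfl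
  rw [hmon, prod_factorial_mul_coeff_sum_X_pow_mul_monomial (by simpa using h)]
  congr 1
  rw [← Finset.prod_subset (Finset.subset_univ A)]
  · refine Finset.prod_congr rfl fun e he => ?_
    rw [hb, if_pos he, Nat.descFactorial_one]
  · intro e _ he
    rw [hb, if_neg he, Nat.descFactorial_zero, Nat.cast_one]

-- For i ∈ A the variable X i occurs squared and the falling factorial is c_i(c_i - 1): this is the
-- source of the correction term in Pólya's argument.
open Nat Classical in
theorem prod_factorial_mul_coeff_sum_X_pow_mul_X_mul_prod_X {N : ℕ} {c : σ →₀ ℕ} {A : Finset σ}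
    (h : c.degree = N + (A.card + 1)) (i : σ) :
    ((∏ e, (c e)! : ℕ) : ℝ) *
        coeff c ((∑ e, X e : MvPolynomial σ ℝ) ^ N * (X i * ∏ a ∈ A, X a)) =
      (N ! : ℝ) * ((c i - if i ∈ A then 1 else 0) * ∏ a ∈ A, (c a : ℝ)) := by
  have hb : ∀ e, (Finsupp.single i 1 + ∑ a ∈ A, Finsupp.single a 1 : σ →₀ ℕ) e =
      (if e ∈ A then 1 else 0) + if e = i then 1 else 0 := by
    intro e
    simp [Finsupp.single_apply, add_comm, eq_comm]
  have hmon : (X i * ∏ a ∈ A, X a : MvPolynomial σ ℝ) =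
      monomial (Finsupp.single i 1 + ∑ a ∈ A, Finsupp.single a 1) 1 := by
    rw [← one_mul (1 : ℝ), ← monomial_mul, monomial_sum_one]; rfl
  rw [hmon, prod_factorial_mul_coeff_sum_X_pow_mul_monomial
    (by rw [h, map_add]; simp [add_comm])]
  congr 1
  have hfac : ∀ e, ((c e).descFactorial
      ((Finsupp.single i 1 + ∑ a ∈ A, Finsupp.single a 1 : σ →₀ ℕ) e) : ℝ) =
      (if e = i then ((c e : ℝ) - if e ∈ A then 1 else 0) else 1) *
        if e ∈ A then (c e : ℝ) else 1 := by
    intro e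
    rw [hb]
    by_cases h1 : e ∈ A <;> by_cases h2 : e = i
    · simp only [h2, if_true, Nat.descFactorial_succ]
      rcases Nat.eq_zero_or_pos (c i) with h0 | h0
      · simp [h0]
      · subst h2
        simp [h1, Nat.cast_sub h0]
    all_goals simp [h1, h2]
    all_goals (subst h2; simp [h1])
  simp only [hfac, Finset.prod_mul_distrib, Finset.prod_ite_eq', Finset.mem_univ, if_true,
    Finset.prod_ite_mem, Finset.univ_inter]

theorem coeff_mul_prod_le_eval {p : MvPolynomial σ ℝ} (hp : ∀ d, 0 ≤ p.coeff d) (c : σ →₀ ℕ)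
    {x : σ → ℝ} (hx : ∀ e, 0 ≤ x e) : p.coeff c * ∏ e, x e ^ c e ≤ eval x p := by
  have hnn : ∀ d ∈ p.support, 0 ≤ p.coeff d * ∏ e, x e ^ d e := fun d _ =>
    mul_nonneg (hp d) (Finset.prod_nonneg fun e _ => pow_nonneg (hx e) _)
  rw [eval_eq']
  by_cases hc : c ∈ p.support
  · exact Finset.single_le_sum hnn hc
  · rw [notMem_support_iff.1 hc, zero_mul]
    exact Finset.sum_nonneg hnn

end MulSumPow

end MvPolynomial

theorem hasOnlyPositiveCoeffs_iff {σ : Type*} {f : MvPolynomial σ ℝ} :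
    HasOnlyPositiveCoeffs f ↔ ∀ d, 0 ≤ f.coeff d := by
  constructor
  · intro h d
    by_cases hd : d ∈ f.support
    · exact (h d hd).le
    · rw [MvPolynomial.notMem_support_iff.1 hd]
  · intro h d hd
    exact lt_of_le_of_ne (h d) (MvPolynomial.mem_support_iff.1 hd).symm

namespace FeynmanGraph

open MvPolynomial

/-! ### Values of the Symanzik polynomials on the nonnegative orthant -/

section Symanzik

variable {V E L : Type*} [Fintype E] {G : FeynmanGraph V E L}

open Classical in
/-- The product of the variables outside of `T`. -/
noncomputable def cotreeProd (T : Finset E) (x : E → ℝ) : ℝ :=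
  ∏ e : E with e ∉ T, x e

theorem cotreeProd_nonneg (T : Finset E) {x : E → ℝ} (hx : ∀ e, 0 ≤ x e) : 0 ≤ cotreeProd T x :=
  Finset.prod_nonneg fun e _ => hx e

theorem cotreeProd_eq_zero {T : Finset E} {x : E → ℝ} {e : E} (he : e ∉ T) (hx : x e = 0) :
    cotreeProd T x = 0 := by
  classical
  exact Finset.prod_eq_zero (by simpa using he) hx

open Classical in
theorem cotreeProd_eq_mul_insert {S : Finset E} {f : E} (hf : f ∉ S) (x : E → ℝ) :
    cotreeProd S x = x f * cotreeProd (insert f S) x := by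
  have h : ({e : E | e ∉ S} : Finset E) = insert f ({e : E | e ∉ insert f S} : Finset E) := by
    ext e
    simp only [Finset.mem_filter, Finset.mem_univ, true_and, Finset.mem_insert]
    grind
  unfold cotreeProd
  rw [h, Finset.prod_insert (by simp)]

open Classical in
/-- The spanning trees, as finite edge sets. -/
noncomputable def spanningTrees (G : FeynmanGraph V E L) : Finset (Finset E) :=
  Finset.univ.filter fun T => G.IsSpanningTree (T : Set E)

open Classical in
/-- The spanning 2-forests, as finite edge sets. -/
noncomputable def twoForests (G : FeynmanGraph V E L) : Finset (Finset E) :=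
  Finset.univ.filter fun S => G.IsTwoForest (S : Set E)

open Classical in
theorem firstSymanzik_eq_sum :
    G.firstSymanzik = ∑ T ∈ G.spanningTrees, ∏ e : E with e ∉ T, X e := by
  rw [firstSymanzik, spanningTrees]
  -- The index set in the definition elaborates to the image of all finite edge sets under the
  -- coercion to `Set E`; injectivity of the coercion brings the sum back to `Finset E`.
  simp only [Finset.bind_def, Finset.pure_def, Finset.sup_singleton_apply, Finset.filter_image]
  rw [@Finset.sum_image _ _ _ _ _ (_) _ _ Finset.coe_injective.injOn]
  simp only [Finset.mem_coe]

open Classical in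
theorem secondSymanzik_eq_sum [Fintype L] (z : KinematicSpace E L) :
    G.secondSymanzik z =
      ∑ S ∈ G.twoForests, C (G.crossing (S : Set E) z.1.2) * ∏ e : E with e ∉ S, X e +
        (∑ e : E, C (z.1.1 e) * X e) * G.firstSymanzik := by
  rw [secondSymanzik, twoForests]
  simp only [Finset.bind_def, Finset.pure_def, Finset.sup_singleton_apply, Finset.filter_image]
  rw [@Finset.sum_image _ _ _ _ _ (_) _ _ Finset.coe_injective.injOn]
  simp only [Finset.mem_coe]

theorem mem_spanningTrees {T : Finset E} :
    T ∈ G.spanningTrees ↔ G.IsSpanningTree (T : Set E) := by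
  simp [spanningTrees]

theorem mem_twoForests {S : Finset E} : S ∈ G.twoForests ↔ G.IsTwoForest (S : Set E) := by
  simp [twoForests]

open Classical in
theorem eval_firstSymanzik (x : E → ℝ) :
    eval x G.firstSymanzik = ∑ T ∈ G.spanningTrees, cotreeProd T x := by
  simp [firstSymanzik_eq_sum, cotreeProd]

open Classical in
theorem eval_secondSymanzik [Fintype L] (z : KinematicSpace E L) (x : E → ℝ) :
    eval x (G.secondSymanzik z) =
      ∑ S ∈ G.twoForests, G.crossing S z.1.2 * cotreeProd S x +
        (∑ e, z.1.1 e * x e) * eval x G.firstSymanzik := by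
  simp [secondSymanzik_eq_sum, cotreeProd]

theorem eval_firstSymanzik_nonneg {x : E → ℝ} (hx : ∀ e, 0 ≤ x e) :
    0 ≤ eval x G.firstSymanzik := by
  classical
  rw [eval_firstSymanzik]
  exact Finset.sum_nonneg fun T _ => cotreeProd_nonneg T hx

theorem cotreeProd_le_eval_firstSymanzik {T : Finset E} (hT : G.IsSpanningTree (T : Set E))
    {x : E → ℝ} (hx : ∀ e, 0 ≤ x e) : cotreeProd T x ≤ eval x G.firstSymanzik := by
  classical
  rw [eval_firstSymanzik]
  exact Finset.single_le_sum (f := fun T => cotreeProd T x)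
    (fun T _ => cotreeProd_nonneg T hx) (mem_spanningTrees.2 hT)

/-- Adding a joining edge f to the 2-forest gives a spanning tree, and the monomial is x_f times
that of the tree. -/
theorem IsTwoForest.cotreeProd_le (hconn : G.IsConnected) {S : Finset E}
    (hS : G.IsTwoForest (S : Set E)) {x : E → ℝ} (hx : ∀ e, 0 ≤ x e) :
    cotreeProd S x ≤ (∑ e, x e) * eval x G.firstSymanzik := by
  classical
  obtain ⟨f, hf, hT⟩ := hS.exists_finset_insert hconn
  rw [cotreeProd_eq_mul_insert hf]
  exact mul_le_mul (Finset.single_le_sum (fun e _ => hx e) (Finset.mem_univ f))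
    (cotreeProd_le_eval_firstSymanzik hT hx) (cotreeProd_nonneg _ hx)
    (Finset.sum_nonneg fun e _ => hx e)

/-- All spanning trees have the same size, so some edge of T lies outside T' and its variable, which
is zero, divides the monomial. -/
theorem IsSpanningTree.cotreeProd_eq_zero [Fintype V] {T T' : Finset E}
    (hT' : G.IsSpanningTree (T' : Set E)) (hT : G.IsSpanningTree (T : Set E)) (hne : T' ≠ T)
    {x : E → ℝ} (hx : ∀ e ∈ T, x e = 0) : cotreeProd T' x = 0 := by
  have hnot : ¬ T ⊆ T' := fun h => hne (Finset.eq_of_subset_of_card_le h (by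
    have := hT.card_add_one; have := hT'.card_add_one; omega)).symm
  obtain ⟨e, he, he'⟩ := Finset.not_subset.1 hnot
  exact FeynmanGraph.cotreeProd_eq_zero he' (hx e he)

/-- At a point that vanishes on the edges of a spanning tree `T`, only `T` contributes to the
first Symanzik polynomial, and no 2-forest contributes to the second one. -/
theorem eval_firstSymanzik_of_eq_zero_on [Fintype V] {T : Finset E}
    (hT : G.IsSpanningTree (T : Set E)) {x : E → ℝ} (hx : ∀ e ∈ T, x e = 0) :
    eval x G.firstSymanzik = cotreeProd T x := by
  rw [eval_firstSymanzik]
  exact Finset.sum_eq_single_of_mem T (mem_spanningTrees.2 hT) fun T' hT' hne =>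
    (mem_spanningTrees.1 hT').cotreeProd_eq_zero hT hne hx

theorem IsTwoForest.cotreeProd_eq_zero [Fintype V] (hconn : G.IsConnected) {S T : Finset E}
    (hS : G.IsTwoForest (S : Set E)) (hT : G.IsSpanningTree (T : Set E))
    {x : E → ℝ} (hx : ∀ e ∈ T, x e = 0) : cotreeProd S x = 0 := by
  classical
  obtain ⟨f, hf, hT'⟩ := hS.exists_finset_insert hconn
  have hnot : ¬ T ⊆ S := fun h => by
    have h1 := Finset.card_le_card h
    have h2 := hT.card_add_one
    have h3 := hT'.card_add_one
    rw [Finset.card_insert_of_notMem hf] at h3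
    omega
  obtain ⟨e, he, he'⟩ := Finset.not_subset.1 hnot
  exact FeynmanGraph.cotreeProd_eq_zero he' (hx e he)

theorem eval_secondSymanzik_of_eq_zero_on [Fintype V] [Fintype L]
    (hconn : G.IsConnected) (z : KinematicSpace E L)
    {T : Finset E} (hT : G.IsSpanningTree (T : Set E)) {x : E → ℝ} (hx : ∀ e ∈ T, x e = 0) :
    eval x (G.secondSymanzik z) = (∑ e, z.1.1 e * x e) * cotreeProd T x := by
  classical
  rw [eval_secondSymanzik, eval_firstSymanzik_of_eq_zero_on hT hx, Finset.sum_eq_zero, zero_add]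
  intro S hS
  rw [IsTwoForest.cotreeProd_eq_zero hconn (mem_twoForests.1 hS) hT hx, mul_zero]

theorem exists_finset_isSpanningTree_notMem (hbridge : G.IsBridgeless) (e : E) :
    ∃ T : Finset E, G.IsSpanningTree (T : Set E) ∧ e ∉ T := by
  classical
  obtain ⟨T, hTe, hT⟩ := exists_isSpanningTree_subset (hbridge e)
  refine ⟨T.toFinset, by simpa using hT, fun h => ?_⟩
  exact hTe (by simpa using h) rfl

/-! ### Coefficients of the product with a power of the sum of the variables -/

-- The degree of U is the loop number. A spanning tree forces |V| ≤ |E| + 1, so the natural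
-- subtraction in this order does not truncate.
open Classical in
theorem IsSpanningTree.card_compl [Fintype V] {T : Finset E} (hT : G.IsSpanningTree (T : Set E)) :
    ({e : E | e ∉ T} : Finset E).card = Fintype.card E + 1 - Fintype.card V := by
  have h := hT.card_add_one
  have h' := Finset.card_compl_add_card T
  have : ({e : E | e ∉ T} : Finset E) = Tᶜ := by ext; simp
  rw [this]
  omega

open Classical in
theorem IsTwoForest.card_compl [Fintype V] (hconn : G.IsConnected) {S : Finset E}
    (hS : G.IsTwoForest (S : Set E)) :
    ({e : E | e ∉ S} : Finset E).card = Fintype.card E + 1 - Fintype.card V + 1 := by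
  obtain ⟨f, hf, hT⟩ := hS.exists_finset_insert hconn
  have h := hT.card_add_one
  have h' := Finset.card_compl_add_card S
  have h2 := Finset.card_le_univ (insert f S)
  rw [Finset.card_insert_of_notMem hf] at h h2
  have : ({e : E | e ∉ S} : Finset E) = Sᶜ := by ext; simp
  rw [this]
  omega

theorem isHomogeneous_firstSymanzik [Fintype V] :
    G.firstSymanzik.IsHomogeneous (Fintype.card E + 1 - Fintype.card V) := by
  classical
  rw [firstSymanzik_eq_sum]
  refine IsHomogeneous.sum _ _ _ fun T hT => ?_
  have hT' : G.IsSpanningTree (T : Set E) := mem_spanningTrees.1 hT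
  have h := IsHomogeneous.prod ({e : E | e ∉ T} : Finset E) (fun e => (X e : MvPolynomial E ℝ))
    (fun _ => 1) fun e _ => isHomogeneous_X ℝ e
  rw [← Finset.card_eq_sum_ones, hT'.card_compl] at h
  exact h

theorem isHomogeneous_secondSymanzik [Fintype V] [Fintype L]
    (hconn : G.IsConnected) (z : KinematicSpace E L) :
    (G.secondSymanzik z).IsHomogeneous (Fintype.card E + 1 - Fintype.card V + 1) := by
  classical
  rw [secondSymanzik_eq_sum]
  refine IsHomogeneous.add (IsHomogeneous.sum _ _ _ fun S hS => ?_) ?_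
  · have hS' : G.IsTwoForest (S : Set E) := mem_twoForests.1 hS
    have h := IsHomogeneous.prod ({e : E | e ∉ S} : Finset E)
      (fun e => (X e : MvPolynomial E ℝ)) (fun _ => 1) fun e _ => isHomogeneous_X ℝ e
    rw [← Finset.card_eq_sum_ones, hS'.card_compl hconn] at h
    simpa using (isHomogeneous_C E (G.crossing (S : Set E) z.1.2)).mul h
  · rw [add_comm]
    exact (IsHomogeneous.sum _ _ _ fun e _ => isHomogeneous_C_mul_X _ e).mul
      isHomogeneous_firstSymanzik

open Nat Classical in
/-- The coefficients of `(∑ X) ^ N * F_z` are, up to positive factors, the values of `F_z` at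
natural numbers, corrected by a term of lower degree. -/
theorem prod_factorial_mul_coeff_secondSymanzik [Fintype V] [Fintype L]
    (hconn : G.IsConnected) (z : KinematicSpace E L)
    {N : ℕ} {c : E →₀ ℕ} (hc : c.degree = N + (Fintype.card E + 1 - Fintype.card V + 1)) :
    ((∏ e, (c e)! : ℕ) : ℝ) *
        coeff c ((∑ e, X e : MvPolynomial E ℝ) ^ N * G.secondSymanzik z) =
      (N ! : ℝ) * (eval (fun e => (c e : ℝ)) (G.secondSymanzik z) -
        ∑ T ∈ G.spanningTrees,
          (∑ e : E with e ∉ T, z.1.1 e) * cotreeProd T (fun e => (c e : ℝ))) := by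
  set P : MvPolynomial E ℝ := (∑ e, X e) ^ N with hP
  have hF : P * G.secondSymanzik z =
      ∑ S ∈ G.twoForests, C (G.crossing (S : Set E) z.1.2) * (P * ∏ e : E with e ∉ S, X e) +
        ∑ T ∈ G.spanningTrees, ∑ i : E, C (z.1.1 i) * (P * (X i * ∏ e : E with e ∉ T, X e)) := by
    clear_value P
    rw [secondSymanzik_eq_sum, firstSymanzik_eq_sum, mul_add, Finset.mul_sum, Finset.sum_mul_sum,
      Finset.sum_comm, Finset.mul_sum]
    refine congrArg₂ _ (Finset.sum_congr rfl fun S _ => mul_left_comm _ _ _)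
      (Finset.sum_congr rfl fun T _ => ?_)
    rw [Finset.mul_sum]
    refine Finset.sum_congr rfl fun i _ => ?_
    rw [mul_assoc, mul_left_comm]
  rw [hF, coeff_add, coeff_sum, coeff_sum, mul_add, Finset.mul_sum, Finset.mul_sum,
    eval_secondSymanzik, eval_firstSymanzik, add_sub_assoc, Finset.mul_sum,
    ← Finset.sum_sub_distrib, mul_add, Finset.mul_sum, Finset.mul_sum]
  congr 1
  · refine Finset.sum_congr rfl fun S hS => ?_
    have hS' : G.IsTwoForest (S : Set E) := mem_twoForests.1 hS
    rw [coeff_C_mul, mul_left_comm, prod_factorial_mul_coeff_sum_X_pow_mul_prod_X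
      (by rw [hS'.card_compl hconn, hc]), mul_left_comm]
    rfl
  · refine Finset.sum_congr rfl fun T hT => ?_
    have hT' : G.IsSpanningTree (T : Set E) := mem_spanningTrees.1 hT
    rw [coeff_sum, ← sub_mul, Finset.sum_filter, ← Finset.sum_sub_distrib, Finset.sum_mul,
      Finset.mul_sum, Finset.mul_sum]
    refine Finset.sum_congr rfl fun i _ => ?_
    rw [coeff_C_mul, mul_left_comm, prod_factorial_mul_coeff_sum_X_pow_mul_X_mul_prod_X
      (by rw [hT'.card_compl, hc]), mul_left_comm, ← mul_assoc (z.1.1 i)]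
    congr 2
    simp only [Finset.mem_filter, Finset.mem_univ, true_and]
    split_ifs <;> ring

end Symanzik
end FeynmanGraph

namespace FeynmanGraph

open MvPolynomial

/-! ### The interior of the copositive cone and strict copositivity -/

section Cone

variable {V E L : Type*} [Fintype L] {G : FeynmanGraph V E L}

theorem continuous_crossing (S : Set E) : Continuous (G.crossing S) := by
  classical
  unfold crossing
  fun_prop

variable [Fintype E]

/-- `F_z` dominates a positive multiple of `(∑ x) * U` on the nonnegative orthant. -/
def IsStrictlyCopositive (G : FeynmanGraph V E L) (z : KinematicSpace E L) : Prop :=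
  ∃ ε > 0, ∀ x : E → ℝ, (∀ e, 0 ≤ x e) →
    ε * ((∑ e, x e) * eval x G.firstSymanzik) ≤ eval x (G.secondSymanzik z)

/-- The kinematic vector with all masses equal to one and vanishing momenta. -/
def unitMasses (E L : Type*) [Fintype L] : KinematicSpace E L :=
  ⟨(fun _ => 1, 0), Matrix.isSymm_zero, fun i => by simp⟩

theorem eval_secondSymanzik_sub_smul_unitMasses (z : KinematicSpace E L) (t : ℝ) (x : E → ℝ) :
    eval x (G.secondSymanzik (z - t • unitMasses E L)) =
      eval x (G.secondSymanzik z) - t * ((∑ e, x e) * eval x G.firstSymanzik) := by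
  have hk : (z - t • unitMasses E L).1.2 = z.1.2 := by simp [unitMasses]
  have hm : ∀ e, (z - t • unitMasses E L).1.1 e = z.1.1 e - t := fun e => by simp [unitMasses]
  rw [eval_secondSymanzik, eval_secondSymanzik, hk]
  simp only [hm, sub_mul, Finset.sum_sub_distrib, ← Finset.mul_sum]
  ring

theorem IsStrictlyCopositive.of_mem_interior {z : KinematicSpace E L}
    (hz : z ∈ interior G.copositiveCone) : G.IsStrictlyCopositive z := by
  have hcont : Continuous fun t : ℝ => z - t • unitMasses E L := by fun_prop
  have hmem : ∀ᶠ t in nhds (0 : ℝ), z - t • unitMasses E L ∈ G.copositiveCone := by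
    refine hcont.continuousAt.eventually_mem ?_
    rw [zero_smul, sub_zero]
    exact mem_interior_iff_mem_nhds.1 hz
  obtain ⟨ε, hε, hpos⟩ :=
    -- Membership holds for all t near 0; restricting to t > 0 provides the ε.
    ((hmem.filter_mono (nhdsWithin_le_nhds (s := Set.Ioi 0))).and self_mem_nhdsWithin).exists
  refine ⟨ε, hpos, fun x hx => ?_⟩
  have h := hε x hx
  rw [eval_secondSymanzik_sub_smul_unitMasses] at h
  linarith

theorem IsStrictlyCopositive.mem_interior (hconn : G.IsConnected) {z : KinematicSpace E L}
    (hz : G.IsStrictlyCopositive z) : z ∈ interior G.copositiveCone := by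
  obtain ⟨ε, hε, hF⟩ := hz
  -- An ℓ¹ distance between the coefficient data of the two polynomials: on the orthant F_z - F_w ≤
  -- D(w) σ U.
  let D : KinematicSpace E L → ℝ := fun w =>
    ∑ S ∈ G.twoForests, |G.crossing S z.1.2 - G.crossing S w.1.2| + ∑ e, |z.1.1 e - w.1.1 e|
  have hD : Continuous D := by
    have hc : ∀ S : Finset E, Continuous fun w : KinematicSpace E L => G.crossing S w.1.2 :=
      fun S => (continuous_crossing _).comp (continuous_snd.comp continuous_subtype_val)
    fun_prop
  have hDz : D z = 0 := by simp [D]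
  have hev : ∀ᶠ w in nhds z, D w < ε := hD.continuousAt.eventually_lt_const (by rwa [hDz])
  rw [mem_interior_iff_mem_nhds]
  filter_upwards [hev] with w hw x hx
  set U := eval x G.firstSymanzik with hU
  have hU0 : 0 ≤ U := eval_firstSymanzik_nonneg hx
  have hσ0 : 0 ≤ ∑ e, x e := Finset.sum_nonneg fun e _ => hx e
  have hforest : ∑ S ∈ G.twoForests, G.crossing S z.1.2 * cotreeProd S x -
      ∑ S ∈ G.twoForests, G.crossing S w.1.2 * cotreeProd S x ≤
      (∑ S ∈ G.twoForests, |G.crossing S z.1.2 - G.crossing S w.1.2|) * ((∑ e, x e) * U) := by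
    rw [← Finset.sum_sub_distrib, Finset.sum_mul]
    refine Finset.sum_le_sum fun S hS => ?_
    rw [← sub_mul]
    exact mul_le_mul (le_abs_self _) ((mem_twoForests.1 hS).cotreeProd_le hconn hx)
      (cotreeProd_nonneg S hx) (abs_nonneg _)
  have hmass : (∑ e, z.1.1 e * x e) * U - (∑ e, w.1.1 e * x e) * U ≤
      (∑ e, |z.1.1 e - w.1.1 e|) * ((∑ e, x e) * U) := by
    rw [← sub_mul, ← mul_assoc, ← Finset.sum_sub_distrib]
    refine mul_le_mul_of_nonneg_right ?_ hU0
    rw [Finset.sum_mul]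
    refine Finset.sum_le_sum fun e _ => ?_
    rw [← sub_mul]
    exact mul_le_mul (le_abs_self _) (Finset.single_le_sum (fun e _ => hx e) (Finset.mem_univ e))
      (hx e) (abs_nonneg _)
  have hz := hF x hx
  rw [eval_secondSymanzik, ← hU] at hz
  rw [eval_secondSymanzik, ← hU]
  have hDw : D w * ((∑ e, x e) * U) ≤ ε * ((∑ e, x e) * U) :=
    mul_le_mul_of_nonneg_right hw.le (mul_nonneg hσ0 hU0)
  simp only [D, add_mul] at hDw
  linarith

theorem IsStrictlyCopositive.mass_pos [Fintype V] (hconn : G.IsConnected)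
    (hbridge : G.IsBridgeless) {z : KinematicSpace E L} (hz : G.IsStrictlyCopositive z) (e : E) :
    0 < z.1.1 e := by
  classical
  obtain ⟨ε, hε, hF⟩ := hz
  obtain ⟨T, hT, heT⟩ := exists_finset_isSpanningTree_notMem hbridge e
  set M := ∑ f, |z.1.1 f| with hM
  have hM0 : 0 ≤ M := Finset.sum_nonneg fun f _ => abs_nonneg _
  -- Chosen so that ε t = M + 1: at the test point ε t ≤ ε σ ≤ M + m_e t, which leaves m_e t ≥ 1.
  set t : ℝ := (M + 1) / ε with ht
  have ht0 : 0 < t := by positivity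
  let y : E → ℝ := fun f => if f ∈ T then 0 else 1
  let x : E → ℝ := fun f => y f + if f = e then t else 0
  have hy0 : ∀ f, 0 ≤ y f := fun f => by dsimp only [y]; split_ifs <;> norm_num
  have hx0 : ∀ f, 0 ≤ x f := fun f =>
    add_nonneg (hy0 f) (by split_ifs <;> first | exact ht0.le | exact le_rfl)
  have hxT : ∀ f ∈ T, x f = 0 := by
    intro f hf
    have : f ≠ e := by rintro rfl; exact heT hf
    simp [x, y, hf, this]
  have hprod : 0 < cotreeProd T x := by
    refine Finset.prod_pos fun f hf => ?_
    have hf' : f ∉ T := by simpa using hf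
    have : y f = 1 := by simp [y, hf']
    have h2 : (0 : ℝ) ≤ if f = e then t else 0 := by
      split_ifs <;> first | exact ht0.le | exact le_rfl
    dsimp only [x]
    linarith
  have h := hF x hx0
  rw [eval_secondSymanzik_of_eq_zero_on hconn z hT hxT, eval_firstSymanzik_of_eq_zero_on hT hxT,
    ← mul_assoc] at h
  have h1 := le_of_mul_le_mul_right h hprod
  have h2 : t ≤ ∑ f, x f := by
    refine le_trans ?_ (Finset.single_le_sum (fun f _ => hx0 f) (Finset.mem_univ e))
    simp only [x, if_true]
    linarith [hy0 e]
  have h3 : ∑ f, z.1.1 f * x f ≤ M + z.1.1 e * t := by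
    have : ∑ f, z.1.1 f * x f = ∑ f, z.1.1 f * y f + z.1.1 e * t := by
      simp [x, mul_add, Finset.sum_add_distrib]
    rw [this, hM]
    gcongr with f
    dsimp only [y]
    split_ifs
    · simp
    · rw [mul_one]; exact le_abs_self _
  have h4 : ε * t = M + 1 := by rw [ht]; field_simp
  have h5 : 0 < z.1.1 e * t := by
    have := mul_le_mul_of_nonneg_left h2 hε.le
    linarith
  exact pos_of_mul_pos_left h5 ht0.le

/-! ### From strict copositivity to positive coefficients -/

open Nat in
/-- Pólya's theorem for the second Symanzik polynomial. -/
theorem IsStrictlyCopositive.exists_hasOnlyPositiveCoeffs [Fintype V] (hconn : G.IsConnected)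
    {z : KinematicSpace E L} (hz : G.IsStrictlyCopositive z) :
    ∃ N : ℕ, HasOnlyPositiveCoeffs ((∑ e : E, X e) ^ N * G.secondSymanzik z) := by
  classical
  obtain ⟨ε, hε, hF⟩ := hz
  set M := ∑ f, |z.1.1 f| with hM
  -- Then ε|c| ≥ εN ≥ M, where M bounds the factor ∑_{e∉T} m_e of every tree in the correction.
  obtain ⟨N, hN⟩ := exists_nat_ge (M / ε)
  refine ⟨N, hasOnlyPositiveCoeffs_iff.2 fun c => ?_⟩
  by_cases hc : c.degree = N + (Fintype.card E + 1 - Fintype.card V + 1)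
  · have hfac : (0 : ℝ) < ((∏ e, (c e)! : ℕ) : ℝ) :=
      Nat.cast_pos.2 (Finset.prod_pos fun e _ => Nat.factorial_pos _)
    refine nonneg_of_mul_nonneg_right (a := ((∏ e, (c e)! : ℕ) : ℝ)) ?_ hfac
    rw [prod_factorial_mul_coeff_secondSymanzik hconn z hc]
    refine mul_nonneg (Nat.cast_nonneg _) (sub_nonneg.2 ?_)
    have hc0 : ∀ e, (0 : ℝ) ≤ (c e : ℝ) := fun e => Nat.cast_nonneg _
    refine le_trans ?_ (hF _ hc0)
    have hU0 := eval_firstSymanzik_nonneg (G := G) hc0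
    have hσ : M ≤ ε * ∑ e, (c e : ℝ) := by
      have h1 : (N : ℝ) ≤ ∑ e, (c e : ℝ) := by
        rw [Finsupp.degree_eq_sum] at hc
        exact_mod_cast (show N ≤ ∑ e, c e by omega)
      rw [div_le_iff₀' hε] at hN
      exact hN.trans (mul_le_mul_of_nonneg_left h1 hε.le)
    rw [← mul_assoc]
    refine le_trans ?_ (mul_le_mul_of_nonneg_right hσ hU0)
    rw [eval_firstSymanzik, Finset.mul_sum]
    refine Finset.sum_le_sum fun T _ => mul_le_mul_of_nonneg_right ?_ (cotreeProd_nonneg T hc0)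
    calc ∑ e : E with e ∉ T, z.1.1 e ≤ ∑ e : E with e ∉ T, |z.1.1 e| :=
          Finset.sum_le_sum fun e _ => le_abs_self _
      _ ≤ M := Finset.sum_le_sum_of_subset_of_nonneg (Finset.subset_univ _)
          fun e _ _ => abs_nonneg _
  -- In every other degree the coefficient is zero by homogeneity.
  · have hhom : ((∑ e : E, X e : MvPolynomial E ℝ) ^ N * G.secondSymanzik z).IsHomogeneous
        (1 * N + (Fintype.card E + 1 - Fintype.card V + 1)) :=
      ((IsHomogeneous.sum _ _ _ fun e _ => isHomogeneous_X ℝ e).pow N).mul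
        (isHomogeneous_secondSymanzik hconn z)
    rw [one_mul] at hhom
    rw [hhom.coeff_eq_zero hc]

/-! ### From positive coefficients to strict copositivity -/

open Nat in
/-- For an edge `e` outside of the spanning tree `T`, the monomial `x_e ^ (N + 1) * ∏_{f ∉ T} x_f`
occurs in `(∑ X) ^ N * F_z`. -/
theorem exists_pos_mul_le_eval_of_notMem [Fintype V] (hconn : G.IsConnected)
    {z : KinematicSpace E L} (hm : ∀ e, 0 < z.1.1 e) {N : ℕ}
    (hN : HasOnlyPositiveCoeffs ((∑ e : E, X e) ^ N * G.secondSymanzik z))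
    {T : Finset E} (hT : G.IsSpanningTree (T : Set E)) {e : E} (he : e ∉ T) :
    ∃ δ > 0, ∀ x : E → ℝ, (∀ f, 0 ≤ x f) →
      δ * (x e ^ (N + 1) * cotreeProd T x) ≤
        (∑ f, x f) ^ N * eval x (G.secondSymanzik z) := by
  classical
  let c : E →₀ ℕ := (∑ f : E with f ∉ T, Finsupp.single f 1) + Finsupp.single e (N + 1)
  have hc : ∀ f, c f = (if f ∉ T then 1 else 0) + if f = e then N + 1 else 0 := by
    intro f
    simp only [c, Finsupp.add_apply, Finsupp.finsetSum_apply, Finsupp.single_apply,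
      Finset.sum_ite_eq', Finset.mem_filter, Finset.mem_univ, true_and, eq_comm (a := e)]
  have hdeg : c.degree = N + (Fintype.card E + 1 - Fintype.card V + 1) := by
    simp only [c, map_add, map_sum, Finsupp.degree_single, Finset.sum_const, hT.card_compl]
    simp
    omega
  -- As c vanishes on T, only T survives in the coefficient formula: no momentum term contributes,
  -- whatever its sign.
  have hcT : ∀ f ∈ T, (c f : ℝ) = 0 := by
    intro f hf
    have : f ≠ e := by rintro rfl; exact he hf
    simp [hc, hf, this]
  have hprod : 0 < cotreeProd T fun f => (c f : ℝ) := by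
    refine Finset.prod_pos fun f hf => ?_
    have hf' : f ∉ T := by simpa using hf
    rw [hc, if_pos hf']
    positivity
  have hsum : ∑ T' ∈ G.spanningTrees, (∑ f : E with f ∉ T', z.1.1 f) *
      cotreeProd T' (fun f => (c f : ℝ)) =
      (∑ f : E with f ∉ T, z.1.1 f) * cotreeProd T fun f => (c f : ℝ) := by
    refine Finset.sum_eq_single_of_mem T (mem_spanningTrees.2 hT) fun T' hT' hne => ?_
    rw [(mem_spanningTrees.1 hT').cotreeProd_eq_zero hT hne hcT, mul_zero]
  have hcoeff := prod_factorial_mul_coeff_secondSymanzik hconn z hdeg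
  -- The correction removes one m_f for each f ∉ T, leaving only the N + 1 extra copies of e.
  have hmass : ∑ f, z.1.1 f * (c f : ℝ) - ∑ f : E with f ∉ T, z.1.1 f = z.1.1 e * (N + 1) := by
    rw [Finset.sum_filter, ← Finset.sum_sub_distrib, Finset.sum_eq_single e]
    · rw [hc, if_pos he, if_pos rfl, if_pos he]; push_cast; ring
    · intro f _ hf
      rw [hc, if_neg hf]
      split_ifs <;> simp
    · simp
  rw [eval_secondSymanzik_of_eq_zero_on hconn z hT hcT, hsum, ← sub_mul, hmass] at hcoeff
  have hfac : (0 : ℝ) < ((∏ e, (c e)! : ℕ) : ℝ) :=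
    Nat.cast_pos.2 (Finset.prod_pos fun e _ => Nat.factorial_pos _)
  have hpos : 0 < coeff c ((∑ e, X e : MvPolynomial E ℝ) ^ N * G.secondSymanzik z) := by
    refine pos_of_mul_pos_right (a := ((∏ e, (c e)! : ℕ) : ℝ)) ?_ hfac.le
    rw [hcoeff]
    have := hm e
    positivity
  refine ⟨_, hpos, fun x hx => ?_⟩
  have h := coeff_mul_prod_le_eval (hasOnlyPositiveCoeffs_iff.1 hN) c hx
  have hmon : ∏ f, x f ^ c f = x e ^ (N + 1) * cotreeProd T x := by
    have h1 : ∀ f, x f ^ c f = (if f = e then x f ^ (N + 1) else 1) *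
        if f ∉ T then x f else 1 := by
      intro f
      rw [hc, pow_add, mul_comm]
      congr 1 <;> split_ifs <;> simp
    rw [Finset.prod_congr rfl fun f _ => h1 f, Finset.prod_mul_distrib, Finset.prod_ite_eq',
      if_pos (Finset.mem_univ e), cotreeProd, Finset.prod_filter]
  rw [hmon] at h
  simpa using h

/-- The extra factor σ makes room for one more variable. For e ∈ T it is x_f, with f replacing e in
T: x_f times the monomial of the new tree is x_e times that of T, both being the monomial of T \
{e}. -/
theorem exists_pos_mul_le_eval [Fintype V] (hconn : G.IsConnected) (hbridge : G.IsBridgeless)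
    {z : KinematicSpace E L} (hm : ∀ e, 0 < z.1.1 e) {N : ℕ}
    (hN : HasOnlyPositiveCoeffs ((∑ e : E, X e) ^ N * G.secondSymanzik z))
    {T : Finset E} (hT : G.IsSpanningTree (T : Set E)) (e : E) :
    ∃ δ > 0, ∀ x : E → ℝ, (∀ f, 0 ≤ x f) →
      δ * (x e ^ (N + 2) * cotreeProd T x) ≤
        (∑ f, x f) ^ (N + 1) * eval x (G.secondSymanzik z) := by
  classical
  have hnn : ∀ x : E → ℝ, (∀ f, 0 ≤ x f) →
      0 ≤ (∑ f, x f) ^ N * eval x (G.secondSymanzik z) := by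
    intro x hx
    -- At exponent 0 the bound says that the value is at least the constant coefficient.
    have h := coeff_mul_prod_le_eval (hasOnlyPositiveCoeffs_iff.1 hN) 0 hx
    have h0 := hasOnlyPositiveCoeffs_iff.1 hN 0
    simp only [map_mul, map_pow, map_sum, eval_X, Finsupp.coe_zero, Pi.zero_apply, pow_zero,
      Finset.prod_const_one, mul_one] at h
    exact h0.trans h
  have hstep : ∀ (f : E) (x : E → ℝ), (∀ g, 0 ≤ x g) →
      x f * ((∑ f, x f) ^ N * eval x (G.secondSymanzik z)) ≤
        (∑ f, x f) ^ (N + 1) * eval x (G.secondSymanzik z) := by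
    intro f x hx
    rw [pow_succ', mul_assoc]
    exact mul_le_mul_of_nonneg_right
      (Finset.single_le_sum (fun e _ => hx e) (Finset.mem_univ f)) (hnn x hx)
  by_cases he : e ∈ T
  · obtain ⟨f, hf, hT'⟩ := hT.exists_exchange (by simpa using he) (hbridge e)
    have hf' : f ∉ T := by simpa using hf
    have hfe : f ≠ e := by rintro rfl; exact hf' he
    have hT'' : G.IsSpanningTree ((insert f (T.erase e) : Finset E) : Set E) := by
      simpa using hT'
    obtain ⟨δ, hδ, h⟩ := exists_pos_mul_le_eval_of_notMem hconn hm hN hT''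
      (e := e) (by simp [hfe.symm])
    refine ⟨δ, hδ, fun x hx => le_trans (le_of_eq ?_)
      ((mul_le_mul_of_nonneg_left (h x hx) (hx f)).trans (hstep f x hx))⟩
    have h1 := cotreeProd_eq_mul_insert (S := T.erase e) (f := f) (by simp [hf']) x
    have h2 := cotreeProd_eq_mul_insert (S := T.erase e) (f := e) (by simp) x
    rw [Finset.insert_erase he] at h2
    calc δ * (x e ^ (N + 2) * cotreeProd T x)
        = δ * x e ^ (N + 1) * (x e * cotreeProd T x) := by ring
      _ = δ * x e ^ (N + 1) * (x f * cotreeProd (insert f (T.erase e)) x) := by rw [← h2, h1]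
      _ = _ := by ring
  · obtain ⟨δ, hδ, h⟩ := exists_pos_mul_le_eval_of_notMem hconn hm hN hT he
    refine ⟨δ, hδ, fun x hx => le_trans (le_of_eq ?_)
      ((mul_le_mul_of_nonneg_left (h x hx) (hx e)).trans (hstep e x hx))⟩
    ring

theorem IsStrictlyCopositive.of_hasOnlyPositiveCoeffs [Fintype V] (hconn : G.IsConnected)
    (hbridge : G.IsBridgeless) {z : KinematicSpace E L} (hm : ∀ e, 0 < z.1.1 e) {N : ℕ}
    (hN : HasOnlyPositiveCoeffs ((∑ e : E, X e) ^ N * G.secondSymanzik z)) :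
    G.IsStrictlyCopositive z := by
  classical
  have hex : ∀ p : G.spanningTrees × E, ∃ δ > 0, ∀ x : E → ℝ, (∀ f, 0 ≤ x f) →
      δ * (x p.2 ^ (N + 2) * cotreeProd p.1.1 x) ≤
        (∑ f, x f) ^ (N + 1) * eval x (G.secondSymanzik z) := fun p =>
    exists_pos_mul_le_eval hconn hbridge hm hN (mem_spanningTrees.1 p.1.2) p.2
  choose δ' hδ' hle' using hex
  -- One δ below the finitely many constants. The `+ 1` in n and t below makes them positive without
  -- any nonemptiness.
  obtain ⟨δ, hδ, hlt⟩ := Pi.exists_forall_pos_add_lt (x := fun _ => (0 : ℝ)) hδ'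
  set n : ℝ := Fintype.card E + 1 with hn
  have hn0 : 0 < n := by positivity
  set t : ℝ := G.spanningTrees.card + 1 with ht
  have ht0 : 0 < t := by positivity
  refine ⟨δ / (n ^ (N + 2) * t), by positivity, fun x hx => ?_⟩
  have hσ0 : 0 ≤ ∑ f, x f := Finset.sum_nonneg fun e _ => hx e
  rcases hσ0.eq_or_lt with hσ | hσ
  -- The origin is treated apart, because the other case cancels σ^(N+1).
  · have hx' : ∀ e, x e = 0 := fun e =>
      (Finset.sum_eq_zero_iff_of_nonneg fun e _ => hx e).1 hσ.symm e (Finset.mem_univ e)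
    have hF : eval x (G.secondSymanzik z) = 0 := by
      rw [eval_secondSymanzik, Finset.sum_eq_zero, zero_add]
      · simp [hx']
      · intro S hS
        obtain ⟨f, hf, -⟩ := (mem_twoForests.1 hS).exists_finset_insert hconn
        rw [cotreeProd_eq_zero hf (hx' f), mul_zero]
    rw [hF, ← hσ, zero_mul, mul_zero]
  · have hne : Nonempty E := by
      by_contra h
      rw [not_nonempty_iff] at h
      simp at hσ
    obtain ⟨e, hmax⟩ := Finite.exists_max x
    have hσle : ∑ f, x f ≤ n * x e := by
      calc ∑ f, x f ≤ ∑ _f : E, x e := Finset.sum_le_sum fun f _ => hmax f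
        _ = Fintype.card E * x e := by simp
        _ ≤ n * x e := mul_le_mul_of_nonneg_right (by rw [hn]; linarith) (hx e)
    have hF0 : ∀ T ∈ G.spanningTrees, δ * ((∑ f, x f) ^ (N + 2) * cotreeProd T x) ≤
        n ^ (N + 2) * ((∑ f, x f) ^ (N + 1) * eval x (G.secondSymanzik z)) := by
      intro T hT
      have h1 := hle' (⟨T, hT⟩, e) x hx
      have h2 : δ ≤ δ' (⟨T, hT⟩, e) := by
        have := hlt (⟨T, hT⟩, e)
        rw [zero_add] at this
        exact this.le
      have hc0 := cotreeProd_nonneg T hx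
      have hxe := hx e
      calc δ * ((∑ f, x f) ^ (N + 2) * cotreeProd T x)
          ≤ δ * ((n * x e) ^ (N + 2) * cotreeProd T x) := by gcongr
        _ = n ^ (N + 2) * (δ * (x e ^ (N + 2) * cotreeProd T x)) := by rw [mul_pow]; ring
        _ ≤ n ^ (N + 2) * (δ' (⟨T, hT⟩, e) * (x e ^ (N + 2) * cotreeProd T x)) := by gcongr
        _ ≤ _ := mul_le_mul_of_nonneg_left h1 (by positivity)
    have hF1 : ∀ T ∈ G.spanningTrees, δ / n ^ (N + 2) * ((∑ f, x f) * cotreeProd T x) ≤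
        eval x (G.secondSymanzik z) := by
      intro T hT
      have h := hF0 T hT
      rw [div_mul_eq_mul_div, div_le_iff₀ (by positivity)]
      refine le_of_mul_le_mul_left ?_ (pow_pos hσ (N + 1))
      calc (∑ f, x f) ^ (N + 1) * (δ * ((∑ f, x f) * cotreeProd T x))
          = δ * ((∑ f, x f) ^ (N + 2) * cotreeProd T x) := by ring
        _ ≤ _ := h
        _ = _ := by ring
    obtain ⟨T₀, hT₀, -⟩ := exists_finset_isSpanningTree_notMem hbridge e
    -- Needed to replace the number of trees by the larger t after summing the bounds over all
    -- trees.
    have hnonneg : 0 ≤ eval x (G.secondSymanzik z) :=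
      le_trans (mul_nonneg (by positivity) (mul_nonneg hσ0 (cotreeProd_nonneg T₀ hx)))
        (hF1 T₀ (mem_spanningTrees.2 hT₀))
    have hsum := Finset.sum_le_card_nsmul G.spanningTrees _ _ hF1
    rw [← Finset.mul_sum, ← Finset.mul_sum, ← eval_firstSymanzik, nsmul_eq_mul] at hsum
    rw [← div_div, div_mul_eq_mul_div, div_le_iff₀ ht0]
    refine hsum.trans ?_
    rw [mul_comm]
    exact mul_le_mul_of_nonneg_left (by rw [ht]; linarith) hnonneg

end Cone

end FeynmanGraph

theorem mainTheorem1 {V E L : Type*} [Fintype V] [Fintype E] [Fintype L]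
    (G : FeynmanGraph V E L) (hconn : G.IsConnected) (hbridge : G.IsBridgeless)
    (z : FeynmanGraph.KinematicSpace E L) :
    z ∈ interior G.copositiveCone ↔
      (∀ e : E, 0 < z.1.1 e) ∧
        ∃ N : ℕ, HasOnlyPositiveCoeffs ((∑ e : E, MvPolynomial.X e) ^ N * G.secondSymanzik z) := by
  exact ⟨fun h =>
      have hz := FeynmanGraph.IsStrictlyCopositive.of_mem_interior h
      ⟨hz.mass_pos hconn hbridge, hz.exists_hasOnlyPositiveCoeffs hconn⟩,
    fun ⟨hm, _, hN⟩ =>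
      (FeynmanGraph.IsStrictlyCopositive.of_hasOnlyPositiveCoeffs hconn hbridge hm hN).mem_interior
        hconn⟩
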